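/- Consider a finite-state generalized semi-Markov process: a finite set $S$ of states, each $s\in S$ with a finite set $I(s)$ of events (clocks), a non-zero rate for each clock, and a set $\mathrm{Props}(s)$ of atomic propositions; for $i\in I(s)$ a probability distribution $\mathrm{next}_i(s,\cdot)$ on $S$; and continuous probability densities $f(t;s,i;s',i')$ on $[0,\infty)$ from which new clock values are drawn. A generalized state is a pair $\langle s,c\rangle$ with $c\in[0,\infty)^{I(s)}$ such that a unique clock of $I(s)$ reaches $0$ first; let $\mathcal G$ be the set of generalized states. Let $\mathrm{Traces}(g)$ be the distribution, started at $g\in\mathcal G$, of the function $[0,\infty)\to\mathcal G$ generated by the (non-Zeno) sequence of generalized states that the process visits; paths that are Zeno or that reach a clock vector without a unique first clock carry no trace and are left out. Pseudometrics are $[0,1]$-valued. For a pseudometric $m$ on $\mathcal G$ let $$J(m)(f,g)=\max\Bigl(\sup_t\inf_{t'}\max\bigl(m(f(t),g(t')),|t-t'|\bigr),\ \sup_{t'}\inf_{t}\max\bigl(m(f(t),g(t')),|t-t'|\bigr)\Bigr)$$ be the Skorohod $J_2$ pseudometric on traces, and for a pseudometric $d$ on traces let $W(d)(P,Q)=\sup_h\bigl|\int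 h\,dP-\int h\,dQ\bigr|$ over all $h$ with values in $[0,1]$ and $|h(x)-h(y)|\le d(x,y)$ (upper integrals if $h$ is not measurable). For $0<k<1$ let $$\mathcal F_k(m)(g,g')=k\cdot W(J(m))\bigl(\mathrm{Traces}(g),\mathrm{Traces}(g')\bigr)$$ if the states of $g$ and $g'$ satisfy the same atomic propositions, and $\mathcal F_k(m)(g,g')=1$ otherwise. Let $\mathcal M$ be the set of pseudometrics $m$ on $\mathcal G$ with $m(g,g')=1$ whenever the states of $g,g'$ satisfy different atomic propositions, ordered by $m_1\preceq m_2$ iff $m_1\ge m_2$ pointwise. Let $\mathcal{PMU}$ be the set of pseudo-metrizable uniformities on $\mathcal G$ (those with basis $\{(x,y): m(x,y)<\varepsilon\}$, $\varepsilon>0$, for some pseudometric $m$), ordered by $\mathcal U_1\le\mathcal U_2$ iff $\mathcal U_2\subseteq\mathcal U_1$. **Theorem.** There is a map $\Phi:\mathcal{PMU}\to\mathcal{PMU}$ such that for every $0<k<1$ the following hold. If $\mathcal U$ is induced by a pseudometric $m$, then $\Phi(\mathcal U)$ is the uniformity induced by $\mathcal F_k(m)$. The functional $\mathcal F_k$ has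 a maximum fixed point $m_{\mathcal F_k}$ in $(\mathcal M,\preceq)$, and the uniformity induced by $m_{\mathcal F_k}$ is the maximum fixed point of $\Phi$ in $(\mathcal{PMU},\le)$. -/

import Mathlib

open MeasureTheory Set
open scoped NNReal ENNReal

/-! ### Pseudometrics with values in `[0,1]` and the uniformities they induce -/

/-- A pseudometric on `X` with values in `[0,1]`. -/
@[ext]
structure UnitPseudometric (X : Type*) where
  dist : X → X → ℝ
  dist_self : ∀ x, dist x x = 0
  dist_comm : ∀ x y, dist x y = dist y x
  dist_triangle : ∀ x y z, dist x z ≤ dist x y + dist y z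
  dist_nonneg : ∀ x y, 0 ≤ dist x y
  dist_le_one : ∀ x y, dist x y ≤ 1

namespace UnitPseudometric

/-- The order on pseudometrics is the reverse of the pointwise order:
`m₁ ≤ m₂` iff `m₁ x y ≥ m₂ x y` for all `x, y`. -/
instance instPartialOrder (X : Type*) : PartialOrder (UnitPseudometric X) where
  le m₁ m₂ := ∀ x y, m₂.dist x y ≤ m₁.dist x y
  le_refl _ _ _ := le_rfl
  le_trans _ _ _ h₁ h₂ x y := (h₂ x y).trans (h₁ x y)
  le_antisymm _ _ h₁ h₂ := UnitPseudometric.ext (funext₂ fun x y => le_antisymm (h₂ x y) (h₁ x y))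

/-- The uniformity induced by a pseudometric: the entourages are the sets that contain
`{(x, y) | m x y < ε}` for some `ε > 0`. -/
@[reducible]
def uniformity {X : Type*} (m : UnitPseudometric X) : UniformSpace X :=
  UniformSpace.ofFun m.dist m.dist_self m.dist_comm m.dist_triangle
    fun ε hε => ⟨ε / 2, half_pos hε, fun _ hx _ hy => by linarith⟩

/-- Pull-back of a pseudometric along a map. -/
def comap {X Y : Type*} (φ : Y → X) (m : UnitPseudometric X) : UnitPseudometric Y where
  dist x y := m.dist (φ x) (φ y)
  dist_self _ := m.dist_self _
  dist_comm _ _ := m.dist_comm _ _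
  dist_triangle _ _ _ := m.dist_triangle _ _ _
  dist_nonneg _ _ := m.dist_nonneg _ _
  dist_le_one _ _ := m.dist_le_one _ _

end UnitPseudometric

/-- The pseudo-metrizable uniformities on `X`. The order is the one of `UniformSpace X`:
`U₁ ≤ U₂` iff every entourage of `U₂` is an entourage of `U₁`. -/
abbrev PseudoMetrizableUniformity (X : Type*) : Type _ :=
  {U : UniformSpace X // ∃ m : UnitPseudometric X, m.uniformity = U}

/-- The uniformity induced by a pseudometric, as an element of the lattice of
pseudo-metrizable uniformities. -/
def UnitPseudometric.toPMU {X : Type*} (m : UnitPseudometric X) : PseudoMetrizableUniformity X :=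
  ⟨m.uniformity, m, rfl⟩

/-! ### The Skorohod J2 pseudometric -/

namespace UnitPseudometric

theorem j2_bddBelow {X : Type*} (m : UnitPseudometric X) (f g : ℝ≥0 → X) (t : ℝ≥0) :
    BddBelow (range fun t' : ℝ≥0 => max (m.dist (f t) (g t')) |(t : ℝ) - t'|) :=
  ⟨0, by rintro _ ⟨t', rfl⟩; exact le_max_of_le_right (abs_nonneg _)⟩

theorem j2_inf_le_one {X : Type*} (m : UnitPseudometric X) (f g : ℝ≥0 → X) (t : ℝ≥0) :
    ⨅ t' : ℝ≥0, max (m.dist (f t) (g t')) |(t : ℝ) - t'| ≤ 1 :=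
  (ciInf_le (m.j2_bddBelow f g t) t).trans (by simpa using m.dist_le_one _ _)

theorem j2_inf_nonneg {X : Type*} (m : UnitPseudometric X) (f g : ℝ≥0 → X) (t : ℝ≥0) :
    0 ≤ ⨅ t' : ℝ≥0, max (m.dist (f t) (g t')) |(t : ℝ) - t'| :=
  le_ciInf fun _ => le_max_of_le_right (abs_nonneg _)

/-- `sup_t inf_{t'} max (m (f t) (g t'), |t - t'|)`. -/
noncomputable def j2Excess {X : Type*} (m : UnitPseudometric X) (f g : ℝ≥0 → X) : ℝ :=
  ⨆ t : ℝ≥0, ⨅ t' : ℝ≥0, max (m.dist (f t) (g t')) |(t : ℝ) - t'|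

theorem j2_bddAbove {X : Type*} (m : UnitPseudometric X) (f g : ℝ≥0 → X) :
    BddAbove (range fun t : ℝ≥0 => ⨅ t' : ℝ≥0, max (m.dist (f t) (g t')) |(t : ℝ) - t'|) :=
  ⟨1, by rintro _ ⟨t, rfl⟩; exact m.j2_inf_le_one f g t⟩

theorem j2Excess_triangle {X : Type*} (m : UnitPseudometric X) (f g h : ℝ≥0 → X) :
    m.j2Excess f h ≤ m.j2Excess f g + m.j2Excess g h := by
  refine ciSup_le fun t => le_of_forall_pos_le_add fun ε hε => ?_
  obtain ⟨t', ht'⟩ := exists_lt_of_ciInf_lt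
    (lt_of_le_of_lt (le_ciSup (m.j2_bddAbove f g) t) (lt_add_of_pos_right _ (half_pos hε)))
  obtain ⟨t'', ht''⟩ := exists_lt_of_ciInf_lt
    (lt_of_le_of_lt (le_ciSup (m.j2_bddAbove g h) t') (lt_add_of_pos_right _ (half_pos hε)))
  refine (ciInf_le (m.j2_bddBelow f h t) t'').trans ?_
  rw [max_lt_iff] at ht' ht''
  have h1 := m.dist_triangle (f t) (g t') (h t'')
  have h2 := abs_sub_le (t : ℝ) t' t''
  unfold j2Excess
  exact max_le (by linarith) (by linarith)

/-- The Skorohod J2 pseudometric: the Hausdorff distance of the graphs of `f` and `g`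
with respect to `max (m x y, |t - t'|)`. -/
noncomputable def skorohodJ2 {X : Type*} (m : UnitPseudometric X) :
    UnitPseudometric (ℝ≥0 → X) where
  dist f g :=
    max (⨆ t : ℝ≥0, ⨅ t' : ℝ≥0, max (m.dist (f t) (g t')) |(t : ℝ) - t'|)
      (⨆ t' : ℝ≥0, ⨅ t : ℝ≥0, max (m.dist (f t) (g t')) |(t : ℝ) - t'|)
  dist_self f := by
    have h : ∀ t : ℝ≥0, ⨅ t' : ℝ≥0, max (m.dist (f t) (f t')) |(t : ℝ) - t'| = 0 := fun t =>
      le_antisymm ((ciInf_le (m.j2_bddBelow f f t) t).trans (by simp [m.dist_self]))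
        (m.j2_inf_nonneg f f t)
    have h' : ∀ t' : ℝ≥0, ⨅ t : ℝ≥0, max (m.dist (f t) (f t')) |(t : ℝ) - t'| = 0 := fun t' => by
      rw [← h t']; congr 1; ext t; rw [m.dist_comm, abs_sub_comm]
    simp [h, h']
  dist_comm f g := by
    rw [max_comm]
    congr 1 <;>
    · congr 1; ext t; congr 1; ext t'; rw [m.dist_comm, abs_sub_comm]
  dist_triangle f g h := by
    have e : ∀ f g : ℝ≥0 → X,
        (⨆ t' : ℝ≥0, ⨅ t : ℝ≥0, max (m.dist (f t) (g t')) |(t : ℝ) - t'|) = m.j2Excess g f := by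
      intro f g; unfold j2Excess
      congr 1; ext t; congr 1; ext t'; rw [m.dist_comm, abs_sub_comm]
    rw [e, e, e]
    have h1 := m.j2Excess_triangle f g h
    have h2 := m.j2Excess_triangle h g f
    have a := le_max_left (m.j2Excess f g) (m.j2Excess g f)
    have b := le_max_right (m.j2Excess f g) (m.j2Excess g f)
    have c := le_max_left (m.j2Excess g h) (m.j2Excess h g)
    have d := le_max_right (m.j2Excess g h) (m.j2Excess h g)
    exact max_le (h1.trans (add_le_add a c)) (h2.trans (by rw [add_comm]; exact add_le_add b d))
  dist_nonneg f g :=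
    le_max_of_le_left (Real.iSup_nonneg fun t => m.j2_inf_nonneg f g t)
  dist_le_one f g := by
    refine max_le (ciSup_le fun t => m.j2_inf_le_one f g t) (ciSup_le fun t => ?_)
    refine le_trans (le_of_eq ?_) (m.j2_inf_le_one g f t)
    congr 1; ext t'; rw [m.dist_comm, abs_sub_comm]

end UnitPseudometric

/-! ### The Wasserstein distance -/

/-- The upper integral of `max h 0` with respect to `P`, that is, the infimum of the integrals of
the measurable functions above it. It is the integral if `h ≥ 0` is integrable. -/
noncomputable def upperIntegral {Y : Type*} [MeasurableSpace Y] (P : Measure Y) (h : Y → ℝ) : ℝ :=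
  (⨅ (φ : Y → ℝ≥0∞) (_ : Measurable φ) (_ : ∀ y, ENNReal.ofReal (h y) ≤ φ y), ∫⁻ y, φ y ∂P).toReal

theorem upperIntegral_eq_integral {Y : Type*} [MeasurableSpace Y] (P : Measure Y) {h : Y → ℝ}
    (hm : Measurable h) (h0 : ∀ y, 0 ≤ h y) : upperIntegral P h = ∫ y, h y ∂P := by
  rw [integral_eq_lintegral_of_nonneg_ae (Filter.Eventually.of_forall h0) hm.aestronglyMeasurable]
  unfold upperIntegral
  congr 1
  refine le_antisymm (iInf_le_of_le _ (iInf_le_of_le hm.ennreal_ofReal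
    (iInf_le_of_le (fun _ => le_rfl) le_rfl))) ?_
  exact le_iInf fun φ => le_iInf fun _ => le_iInf fun hφ => lintegral_mono hφ

theorem upperIntegral_nonneg {Y : Type*} [MeasurableSpace Y] (P : Measure Y) (h : Y → ℝ) :
    0 ≤ upperIntegral P h := ENNReal.toReal_nonneg

theorem upperIntegral_le_one {Y : Type*} [MeasurableSpace Y] {P : Measure Y} (hP : P univ ≤ 1)
    {h : Y → ℝ} (h1 : ∀ y, h y ≤ 1) : upperIntegral P h ≤ 1 := by
  refine ENNReal.toReal_le_of_le_ofReal zero_le_one ?_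
  refine iInf_le_of_le (fun _ => 1) (iInf_le_of_le measurable_const
    (iInf_le_of_le (fun y => ?_) ?_))
  · simpa using h1 y
  · simpa using hP

/-- The test functions of the Wasserstein linear program: all `h : Y → [0,1]` with
`|h y - h y'| ≤ m y y'`. -/
def UnitPseudometric.TestFunction {Y : Type*} (m : UnitPseudometric Y) : Set (Y → ℝ) :=
  {h | (∀ y, 0 ≤ h y ∧ h y ≤ 1) ∧ ∀ y y', |h y - h y'| ≤ m.dist y y'}

/-- The Wasserstein distance `sup_h |∫ h dP - ∫ h dQ|`. The absolute value changes nothing for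
measurable test functions and probability measures, as `1 - h` is a test function when `h` is.
For test functions that are not measurable the integral is the upper integral. -/
noncomputable def UnitPseudometric.wasserstein {Y : Type*} [MeasurableSpace Y]
    (m : UnitPseudometric Y) (P Q : Measure Y) : ℝ :=
  ⨆ h : m.TestFunction, |upperIntegral P h.1 - upperIntegral Q h.1|

namespace UnitPseudometric

theorem abs_upperIntegral_sub_le_one {Y : Type*} [MeasurableSpace Y] (m : UnitPseudometric Y)
    {P Q : Measure Y} (hP : P univ ≤ 1) (hQ : Q univ ≤ 1) (h : m.TestFunction) :
    |upperIntegral P h.1 - upperIntegral Q h.1| ≤ 1 := by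
  have a := upperIntegral_nonneg P h.1
  have b := upperIntegral_nonneg Q h.1
  have c := upperIntegral_le_one hP fun y => (h.2.1 y).2
  have d := upperIntegral_le_one hQ fun y => (h.2.1 y).2
  exact abs_le.2 ⟨by linarith, by linarith⟩

instance {Y : Type*} (m : UnitPseudometric Y) : Nonempty m.TestFunction :=
  ⟨⟨fun _ => 0, by simp, by simpa using m.dist_nonneg⟩⟩

theorem wasserstein_le_one {Y : Type*} [MeasurableSpace Y] (m : UnitPseudometric Y)
    {P Q : Measure Y} (hP : P univ ≤ 1) (hQ : Q univ ≤ 1) : m.wasserstein P Q ≤ 1 :=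
  ciSup_le fun h => m.abs_upperIntegral_sub_le_one hP hQ h

theorem wasserstein_triangle {Y : Type*} [MeasurableSpace Y] (m : UnitPseudometric Y)
    {P Q R : Measure Y} (hP : P univ ≤ 1) (hQ : Q univ ≤ 1) (hR : R univ ≤ 1) :
    m.wasserstein P R ≤ m.wasserstein P Q + m.wasserstein Q R := by
  have bdd : ∀ {P Q : Measure Y}, P univ ≤ 1 → Q univ ≤ 1 →
      BddAbove (range fun h : m.TestFunction => |upperIntegral P h.1 - upperIntegral Q h.1|) :=
    fun hP hQ => ⟨1, by rintro _ ⟨h, rfl⟩; exact m.abs_upperIntegral_sub_le_one hP hQ h⟩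
  exact ciSup_le fun h => (abs_sub_le _ (upperIntegral Q h.1) _).trans
    (add_le_add (le_ciSup (bdd hP hQ) h) (le_ciSup (bdd hQ hR) h))

end UnitPseudometric

/-! ### Finite-state generalized semi-Markov processes -/

/-- Lebesgue measure on `[0, ∞)`. -/
noncomputable def lebesgueNNReal : Measure ℝ≥0 :=
  (volume : Measure ℝ).comap NNReal.toReal

/-- A finite-state generalized semi-Markov process with atomic propositions `AP`, states `S` and
event names `E`. An event and its clock are identified; a clock that is set when event `i` leads
from `s` to `s'` gets a value with density `density s i s' i'`. -/
structure GSMP (AP S E : Type*) [Fintype S] where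
  events : S → Finset E
  rate : ∀ s, events s → ℝ≥0
  rate_ne_zero : ∀ s i, rate s i ≠ 0
  props : S → Set AP
  density : ∀ s, events s → ∀ s', events s' → ℝ≥0 → ℝ≥0
  continuous_density : ∀ s i s' i', Continuous (density s i s' i')
  lintegral_density : ∀ s i s' i', ∫⁻ t, (density s i s' i' t : ℝ≥0∞) ∂lebesgueNNReal = 1
  next : ∀ s, events s → S → ℝ≥0
  sum_next : ∀ s i, ∑ s', next s i s' = 1

namespace GSMP

section

variable {AP S E : Type*} [Fintype S] (M : GSMP AP S E)

/-- A state together with a vector of clock values. -/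
abbrev Config : Type _ := Σ s : S, (M.events s → ℝ≥0)

variable {M}

/-- The time after which clock `i` reaches `0`. -/
noncomputable def timeToZero (x : M.Config) (i : M.events x.1) : ℝ≥0 := x.2 i / M.rate x.1 i

/-- Clock `i` reaches `0` strictly before all other clocks. -/
def IsFirst (x : M.Config) (i : M.events x.1) : Prop :=
  ∀ j, j ≠ i → timeToZero x i < timeToZero x j

variable (M) in
/-- Generalized states: there is a unique clock that reaches `0` first. -/
abbrev GenState : Type _ := {x : M.Config // ∃ i, IsFirst x i}

/-- The clock that reaches `0` first. -/
noncomputable def firstClock (g : M.GenState) : M.events g.1.1 := g.2.choose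

/-- The time required for the first clock to reach `0`. -/
noncomputable def sojourn (g : M.GenState) : ℝ≥0 := timeToZero g.1 (firstClock g)

theorem isFirst_firstClock (g : M.GenState) : IsFirst g.1 (firstClock g) := g.2.choose_spec

theorem IsFirst.eq {x : M.Config} {i j : M.events x.1} (hi : IsFirst x i) (hj : IsFirst x j) :
    i = j := by
  by_contra h
  exact lt_asymm (hi j (Ne.symm h)) (hj i h)

theorem sojourn_le (g : M.GenState) (j : M.events g.1.1) : sojourn g ≤ timeToZero g.1 j := by
  by_cases h : j = firstClock g
  · rw [h]; rfl
  · exact (isFirst_firstClock g j h).le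

/-- The configuration in which every clock has run down at its rate for time `u`. -/
def flow (x : M.Config) (u : ℝ≥0) : M.Config := ⟨x.1, fun i => x.2 i - M.rate x.1 i * u⟩

theorem timeToZero_flow (x : M.Config) (u : ℝ≥0) (i : M.events x.1) :
    timeToZero (flow x u) i = timeToZero x i - u := by
  have h := M.rate_ne_zero x.1 i
  change (x.2 i - M.rate x.1 i * u) / M.rate x.1 i = x.2 i / M.rate x.1 i - u
  rw [NNReal.sub_div, mul_div_cancel_left₀ _ h]

/-- The generalized state reached from `g` after time `u` (or after time `sojourn g`, if `u` is
larger), while no event occurs. -/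
noncomputable def evolve (g : M.GenState) (u : ℝ≥0) : M.GenState :=
  ⟨flow g.1 (min u (sojourn g)), firstClock g, fun j hj => by
    refine lt_of_eq_of_lt (timeToZero_flow _ _ _)
      (lt_of_lt_of_eq ?_ (timeToZero_flow g.1 _ j).symm)
    exact tsub_lt_tsub_right_of_le (min_le_right _ _) (isFirst_firstClock g j hj)⟩

/-! #### The process on generalized states -/

open Classical in
/-- The clock values in `s'` after event `i` has occurred in configuration `x`: the clocks of
`I(s) \ {i}` that are in `I(s')` carry their values forward, the others get the values `fresh`. -/
noncomputable def nextClocks (x : M.Config) (i : M.events x.1) (s' : S)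
    (fresh : M.events s' → ℝ≥0) : M.events s' → ℝ≥0 := fun i' =>
  if h : ∃ hi : i'.1 ∈ M.events x.1, (⟨i'.1, hi⟩ : M.events x.1) ≠ i then
    x.2 ⟨i'.1, h.1⟩ - M.rate x.1 ⟨i'.1, h.1⟩ * timeToZero x i
  else fresh i'

variable (M) in
/-- The law of independent fresh values for the clocks of `s'`. -/
noncomputable def freshLaw (s : S) (i : M.events s) (s' : S) : Measure (M.events s' → ℝ≥0) :=
  Measure.pi fun i' => lebesgueNNReal.withDensity fun t => (M.density s i s' i' t : ℝ≥0∞)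

instance (s : S) (i : M.events s) (s' : S) : IsProbabilityMeasure (M.freshLaw s i s') := by
  have : ∀ i', IsProbabilityMeasure
      (lebesgueNNReal.withDensity fun t => (M.density s i s' i' t : ℝ≥0∞)) := fun i' =>
    ⟨by rw [withDensity_apply _ MeasurableSet.univ, Measure.restrict_univ, M.lintegral_density]⟩
  unfold freshLaw
  infer_instance

/-- The law of the next configuration when event `i` occurs in configuration `x`. -/
noncomputable def eventLaw (x : M.Config) (i : M.events x.1) : Measure M.Config :=
  ∑ s', (M.next x.1 i s' : ℝ≥0∞) •
    (M.freshLaw x.1 i s').map fun fresh => (⟨s', nextClocks x i s' fresh⟩ : M.Config)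

open Classical in
/-- The law of the next configuration. A configuration that is not a generalized state is
absorbing. -/
noncomputable def stepLaw (x : M.Config) : Measure M.Config :=
  if h : ∃ i, IsFirst x i then eventLaw x h.choose else Measure.dirac x

theorem measurable_config_mk (s : S) :
    Measurable fun c : M.events s → ℝ≥0 => (⟨s, c⟩ : M.Config) := by
  intro A hA
  exact MeasurableSpace.measurableSet_iInf.1 hA s

theorem measurableSet_of_config {A : Set M.Config}
    (h : ∀ s, MeasurableSet {c : M.events s → ℝ≥0 | (⟨s, c⟩ : M.Config) ∈ A}) :
    MeasurableSet A :=
  MeasurableSpace.measurableSet_iInf.2 h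

theorem measurable_of_config {Z : Type*} [MeasurableSpace Z] {φ : M.Config → Z}
    (h : ∀ s, Measurable fun c : M.events s → ℝ≥0 => φ ⟨s, c⟩) : Measurable φ := by
  intro A hA
  exact MeasurableSpace.measurableSet_iInf.2 fun s => h s hA

/-- A function that agrees with measurable functions on the pieces of a countable measurable cover
is measurable. -/
theorem measurable_of_cover {X Z ι : Type*} [MeasurableSpace X] [MeasurableSpace Z] [Countable ι]
    {φ : X → Z} (D : ι → Set X) (hD : ∀ i, MeasurableSet (D i)) (hU : ∀ x, ∃ i, x ∈ D i)
    (ψ : ι → X → Z) (hψ : ∀ i, Measurable (ψ i)) (h : ∀ i, ∀ x ∈ D i, φ x = ψ i x) :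
    Measurable φ := by
  intro A hA
  have : φ ⁻¹' A = ⋃ i, D i ∩ ψ i ⁻¹' A := by
    ext x
    simp only [mem_preimage, mem_iUnion, mem_inter_iff]
    constructor
    · intro hx
      obtain ⟨i, hi⟩ := hU x
      exact ⟨i, hi, h i x hi ▸ hx⟩
    · rintro ⟨i, hi, hx⟩
      rw [h i x hi]
      exact hx
  rw [this]
  exact MeasurableSet.iUnion fun i => (hD i).inter (hψ i hA)

theorem measurable_timeToZero (s : S) (i : M.events s) :
    Measurable fun c : M.events s → ℝ≥0 => timeToZero (M := M) ⟨s, c⟩ i := by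
  have h : Measurable fun c : M.events s → ℝ≥0 => c i := measurable_pi_apply i
  exact h.div_const (M.rate s i)

theorem measurableSet_isFirst (s : S) (i : M.events s) :
    MeasurableSet {c : M.events s → ℝ≥0 | IsFirst (M := M) ⟨s, c⟩ i} := by
  have : {c : M.events s → ℝ≥0 | IsFirst (M := M) ⟨s, c⟩ i} =
      ⋂ j : M.events s, ⋂ _ : j ≠ i,
        {c | timeToZero (M := M) ⟨s, c⟩ i < timeToZero (M := M) ⟨s, c⟩ j} := by
    ext c; simp only [mem_ofPred_eq, mem_iInter]; rfl
  rw [this]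
  exact MeasurableSet.iInter fun j => MeasurableSet.iInter fun _ =>
    measurableSet_lt (measurable_timeToZero s i) (measurable_timeToZero s j)

theorem measurable_nextClocks (s : S) (i : M.events s) (s' : S) :
    Measurable fun p : (M.events s → ℝ≥0) × (M.events s' → ℝ≥0) =>
      nextClocks (M := M) ⟨s, p.1⟩ i s' p.2 := by
  refine measurable_pi_lambda _ fun i' => ?_
  unfold nextClocks
  by_cases h : ∃ hi : i'.1 ∈ M.events s, (⟨i'.1, hi⟩ : M.events s) ≠ i
  · simp only [dif_pos h]
    have h1 : Measurable fun p : (M.events s → ℝ≥0) × (M.events s' → ℝ≥0) => p.1 ⟨i'.1, h.1⟩ :=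
      (measurable_pi_apply _).comp measurable_fst
    have h2 : Measurable fun p : (M.events s → ℝ≥0) × (M.events s' → ℝ≥0) =>
        timeToZero (M := M) ⟨s, p.1⟩ i := (measurable_timeToZero s i).comp measurable_fst
    exact h1.sub (h2.const_mul (M.rate s ⟨i'.1, h.1⟩))
  · simp only [dif_neg h]
    exact (measurable_pi_apply _).comp measurable_snd

theorem measurable_eventLaw (s : S) (i : M.events s) :
    Measurable fun c : M.events s → ℝ≥0 => eventLaw (M := M) ⟨s, c⟩ i := by
  refine Measure.measurable_of_measurable_coe _ fun A hA => ?_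
  have hm : ∀ s', Measurable fun p : (M.events s → ℝ≥0) × (M.events s' → ℝ≥0) =>
      (⟨s', nextClocks (M := M) ⟨s, p.1⟩ i s' p.2⟩ : M.Config) := fun s' =>
    (measurable_config_mk s').comp (measurable_nextClocks s i s')
  unfold eventLaw
  simp only [Measure.coe_finsetSum, Finset.sum_apply, Measure.smul_apply, smul_eq_mul]
  refine Finset.measurable_sum _ fun s' _ => Measurable.const_mul ?_ _
  have := measurable_measure_prodMk_left (ν := M.freshLaw s i s') (hm s' hA)
  convert this using 2 with c
  exact Measure.map_apply ((hm s').comp measurable_prodMk_left) hA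

theorem stepLaw_eq {x : M.Config} {i : M.events x.1} (hi : IsFirst x i) :
    stepLaw x = eventLaw x i := by
  have h : ∃ i, IsFirst x i := ⟨i, hi⟩
  unfold stepLaw
  rw [dif_pos h, h.choose_spec.eq hi]

theorem measurable_stepLaw : Measurable (stepLaw (M := M)) := by
  refine measurable_of_config fun s => ?_
  refine measurable_of_cover (ι := Option (M.events s))
    (fun o => o.elim (⋃ i : M.events s, {c | IsFirst (M := M) ⟨s, c⟩ i})ᶜ
      fun i : M.events s => {c | IsFirst (M := M) ⟨s, c⟩ i}) ?_ ?_
    (fun o => o.elim (fun c => Measure.dirac (⟨s, c⟩ : M.Config))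
      fun i c => eventLaw (M := M) ⟨s, c⟩ i) ?_ ?_
  · rintro (_ | i)
    · exact (MeasurableSet.iUnion fun i => measurableSet_isFirst s i).compl
    · exact measurableSet_isFirst s i
  · intro c
    by_cases h : ∃ i, IsFirst (M := M) ⟨s, c⟩ i
    · exact ⟨some h.choose, h.choose_spec⟩
    · exact ⟨none, by simpa using h⟩
  · rintro (_ | i)
    · exact Measure.measurable_dirac.comp (measurable_config_mk s)
    · exact measurable_eventLaw s i
  · rintro (_ | i) c hc
    · have h : ¬ ∃ i, IsFirst (M := M) ⟨s, c⟩ i := by simpa using hc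
      exact dif_neg h
    · exact stepLaw_eq (M := M) (x := ⟨s, c⟩) hc

instance (x : M.Config) (i : M.events x.1) : IsProbabilityMeasure (eventLaw x i) := by
  constructor
  have hm : ∀ s', Measurable fun fresh : M.events s' → ℝ≥0 =>
      (⟨s', nextClocks x i s' fresh⟩ : M.Config) := fun s' =>
    (measurable_config_mk s').comp
      ((measurable_nextClocks x.1 i s').comp (measurable_prodMk_left (x := x.2)))
  unfold eventLaw
  simp only [Measure.coe_finsetSum, Finset.sum_apply, Measure.smul_apply, smul_eq_mul]
  have : ∀ s', ((M.freshLaw x.1 i s').map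
      fun fresh => (⟨s', nextClocks x i s' fresh⟩ : M.Config)) univ = 1 := fun s' => by
    rw [Measure.map_apply (hm s') MeasurableSet.univ, preimage_univ, measure_univ]
  simp only [this, mul_one]
  rw [← ENNReal.ofNNReal_finsetSum, M.sum_next, ENNReal.coe_one]

instance (x : M.Config) : IsProbabilityMeasure (stepLaw x) := by
  unfold stepLaw
  split_ifs <;> infer_instance

variable (M) in
/-- The transition kernel of the discrete-time Markov process. -/
noncomputable def stepKernel : ProbabilityTheory.Kernel M.Config M.Config :=
  ⟨stepLaw, measurable_stepLaw⟩

instance : ProbabilityTheory.IsMarkovKernel M.stepKernel :=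
  ⟨fun x => inferInstanceAs (IsProbabilityMeasure (stepLaw x))⟩

/-- The law of the Markov process that starts at `x` and has transition kernel `stepKernel`. -/
noncomputable def processLaw (x : M.Config) : Measure (ℕ → M.Config) :=
  ProbabilityTheory.Kernel.trajMeasure (X := fun _ => M.Config) (Measure.dirac x) fun n =>
    M.stepKernel.comap (fun y => y ⟨n, Finset.mem_Iic.2 le_rfl⟩) (measurable_pi_apply _)

instance (x : M.Config) : IsProbabilityMeasure (processLaw x) := by
  unfold processLaw; infer_instance

/-! #### Traces -/

variable (M) in
/-- The finitely varying (non-Zeno) sequences of generalized states: the sum of the times spent in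
the generalized states diverges. -/
abbrev FinVarSeq : Type _ := {x : ℕ → M.GenState // ¬ Summable fun n => sojourn (x n)}

/-- The time at which the `n`-th generalized state of the sequence is entered. -/
noncomputable def entryTime (x : M.FinVarSeq) (n : ℕ) : ℝ≥0 :=
  ∑ k ∈ Finset.range n, sojourn (x.1 k)

theorem exists_lt_entryTime (x : M.FinVarSeq) (t : ℝ≥0) : ∃ n, t < entryTime x (n + 1) := by
  by_contra! h
  refine x.2 (NNReal.summable_of_sum_range_le (c := t) fun n => ?_)
  exact le_trans (Finset.sum_le_sum_of_subset (by simp)) (h n)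

open Classical in
/-- The function `[0, ∞) → GenState` generated by a finitely varying sequence: if
`entryTime x n ≤ t < entryTime x (n + 1)`, its value at `t` is the generalized state that is
reached from `x n` after time `t - entryTime x n`. -/
noncomputable def toFunction (x : M.FinVarSeq) (t : ℝ≥0) : M.GenState :=
  evolve (x.1 (Nat.find (exists_lt_entryTime x t)))
    (t - entryTime x (Nat.find (exists_lt_entryTime x t)))

theorem toFunction_eq (x : M.FinVarSeq) {t : ℝ≥0} {n : ℕ} (h₁ : entryTime x n ≤ t)
    (h₂ : t < entryTime x (n + 1)) : toFunction x t = evolve (x.1 n) (t - entryTime x n) := by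
  classical
  have h : Nat.find (exists_lt_entryTime x t) = n := by
    rw [Nat.find_eq_iff]
    refine ⟨h₂, fun k hk => not_lt.2 (le_trans ?_ h₁)⟩
    exact Finset.sum_le_sum_of_subset (by simpa using hk)
  unfold toFunction
  rw [h]

variable (M) in
/-- The traces: the functions generated by finitely varying sequences. Their sigma-algebra is the
one generated by the evaluations. -/
abbrev Trace : Type _ := {f : ℝ≥0 → M.GenState // ∃ x : M.FinVarSeq, toFunction x = f}

/-- The trace of a finitely varying sequence. -/
noncomputable def toTrace (x : M.FinVarSeq) : M.Trace := ⟨toFunction x, x, rfl⟩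

/-- The sequence of configurations underlying a finitely varying sequence. -/
def toConfigSeq (x : M.FinVarSeq) : ℕ → M.Config := fun n => (x.1 n).1

/-- The distribution on traces from the generalized state `g`: the law of the process is
restricted to the finitely varying sequences of generalized states and pushed forward to traces. -/
noncomputable def traceLaw (g : M.GenState) : Measure M.Trace :=
  ((processLaw g.1).comap toConfigSeq).map toTrace

/-! The maps in the definition of `traceLaw` are measurable, so `comap` and `map` are the genuine
operations. -/

theorem measurableSet_isGenState : MeasurableSet {x : M.Config | ∃ i, IsFirst x i} := by
  refine measurableSet_of_config fun s => ?_
  convert MeasurableSet.iUnion fun i => measurableSet_isFirst (M := M) s i using 1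
  ext c
  simp only [mem_iUnion, mem_ofPred_eq]

theorem measurable_of_genState {Z : Type*} [MeasurableSpace Z] {φ : M.GenState → Z}
    (ψ : ∀ s, M.events s → (M.events s → ℝ≥0) → Z) (hψ : ∀ s i, Measurable (ψ s i))
    (h : ∀ g : M.GenState, φ g = ψ g.1.1 (firstClock g) g.1.2) : Measurable φ := by
  classical
  intro A hA
  let B : Set M.Config := {x | ∃ i, IsFirst x i ∧ ψ x.1 i x.2 ∈ A}
  have hB : MeasurableSet B := by
    refine measurableSet_of_config fun s => ?_
    convert MeasurableSet.iUnion fun i => (measurableSet_isFirst (M := M) s i).inter (hψ s i hA)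
      using 1
    ext c
    simp only [mem_iUnion, mem_ofPred_eq, mem_inter_iff, mem_preimage, B]
  have : φ ⁻¹' A = Subtype.val ⁻¹' B := by
    ext g
    simp only [mem_preimage, h]
    constructor
    · exact fun hg => ⟨firstClock g, isFirst_firstClock g, hg⟩
    · rintro ⟨i, hi, hg⟩
      rwa [← hi.eq (isFirst_firstClock g)]
  rw [this]
  exact measurable_subtype_coe hB

theorem measurable_sojourn : Measurable (sojourn (M := M)) :=
  measurable_of_genState (fun s i c => timeToZero (M := M) ⟨s, c⟩ i) measurable_timeToZero
    fun _ => rfl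

theorem measurable_flow : Measurable fun p : M.Config × ℝ≥0 => flow p.1 p.2 := by
  classical
  have hs : ∀ s : S, MeasurableSet {x : M.Config | x.1 = s} := fun s =>
    measurableSet_of_config fun s' => by
      simp only [mem_ofPred_eq]
      exact MeasurableSet.const _
  let pr : ∀ s, M.Config → (M.events s → ℝ≥0) := fun s x => if h : x.1 = s then h ▸ x.2 else 0
  have hpr : ∀ s, Measurable (pr s) := fun s => measurable_of_config fun s' => by
    by_cases h : s' = s
    · subst h
      simp only [pr, dif_pos]
      exact measurable_id
    · simp [pr, h]
  refine measurable_of_cover (fun s => {p : M.Config × ℝ≥0 | p.1.1 = s})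
    (fun s => measurable_fst (hs s)) (fun p => ⟨_, rfl⟩)
    (fun s p => flow (M := M) ⟨s, pr s p.1⟩ p.2) (fun s => ?_) ?_
  · refine (measurable_config_mk s).comp (measurable_pi_lambda _ fun i => ?_)
    have h1 : Measurable fun p : M.Config × ℝ≥0 => pr s p.1 i :=
      (measurable_pi_apply i).comp ((hpr s).comp measurable_fst)
    have h2 : Measurable fun p : M.Config × ℝ≥0 => M.rate s i * p.2 := measurable_snd.const_mul _
    exact h1.sub h2
  · rintro s ⟨⟨s', c⟩, u⟩ rfl
    simp [pr]

theorem measurable_evolve : Measurable fun p : M.GenState × ℝ≥0 => evolve p.1 p.2 :=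
  Measurable.subtype_mk (measurable_flow.comp
    ((measurable_subtype_coe.comp measurable_fst).prodMk
      (measurable_snd.min (measurable_sojourn.comp measurable_fst))))

theorem measurable_entryTime (n : ℕ) : Measurable fun x : M.FinVarSeq => entryTime x n := by
  unfold entryTime
  exact Finset.measurable_sum _ fun k _ =>
    measurable_sojourn.comp ((measurable_pi_apply k).comp measurable_subtype_coe)

theorem measurable_toTrace : Measurable (toTrace (M := M)) := by
  classical
  refine Measurable.subtype_mk (measurable_pi_lambda _ fun t => ?_)
  refine measurable_of_cover
    (fun n => {x : M.FinVarSeq | entryTime x n ≤ t ∧ t < entryTime x (n + 1)})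
    (fun n => ((measurable_entryTime n) measurableSet_Iic).inter
      ((measurable_entryTime (n + 1)) measurableSet_Ioi)) (fun x => ?_)
    (fun n x => evolve (x.1 n) (t - entryTime x n)) (fun n => ?_)
    (fun n x hx => toFunction_eq x hx.1 hx.2)
  · refine ⟨Nat.find (exists_lt_entryTime x t), ?_, Nat.find_spec (exists_lt_entryTime x t)⟩
    cases h : Nat.find (exists_lt_entryTime x t) with
    | zero => simp [entryTime]
    | succ k => exact not_lt.1 (Nat.find_min (exists_lt_entryTime x t) (h ▸ Nat.lt_succ_self k))
  · exact measurable_evolve.comp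
      (((measurable_pi_apply n).comp measurable_subtype_coe).prodMk
        (measurable_const.sub (measurable_entryTime n)))

theorem measurableEmbedding_toConfigSeq :
    MeasurableEmbedding (toConfigSeq (M := M)) := by
  have h1 : MeasurableEmbedding (Subtype.val : M.FinVarSeq → (ℕ → M.GenState)) := by
    refine MeasurableEmbedding.subtype_coe (MeasurableSet.compl ?_)
    have : {x : ℕ → M.GenState | Summable fun n => sojourn (x n)} =
        ⋃ c : ℕ, ⋂ n : ℕ, {x | ∑ k ∈ Finset.range n, sojourn (x k) ≤ c} := by
      ext x
      simp only [mem_ofPred_eq, mem_iUnion, mem_iInter]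
      constructor
      · intro hx
        obtain ⟨c, hc⟩ := exists_nat_ge (∑' n, sojourn (x n))
        exact ⟨c, fun n => (hx.sum_le_tsum _ fun _ _ => zero_le).trans hc⟩
      · rintro ⟨c, hc⟩
        exact NNReal.summable_of_sum_range_le hc
    change MeasurableSet {x : ℕ → M.GenState | Summable fun n => sojourn (x n)}
    rw [this]
    exact MeasurableSet.iUnion fun c => MeasurableSet.iInter fun n =>
      measurableSet_le (Finset.measurable_sum _ fun k _ =>
        measurable_sojourn.comp (measurable_pi_apply k)) measurable_const
  have h2 : MeasurableEmbedding fun (x : ℕ → M.GenState) n => ((x n).1 : M.Config) := by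
    classical
    have hr : MeasurableSet {y : ℕ → M.Config | ∀ n, ∃ i, IsFirst (y n) i} := by
      have : {y : ℕ → M.Config | ∀ n, ∃ i, IsFirst (y n) i} =
          ⋂ n, (fun y => y n) ⁻¹' {x : M.Config | ∃ i, IsFirst x i} := by
        ext y; simp
      exact this ▸ MeasurableSet.iInter fun n => measurable_pi_apply n measurableSet_isGenState
    let e : (ℕ → M.GenState) ≃ᵐ {y : ℕ → M.Config // ∀ n, ∃ i, IsFirst (y n) i} :=
      { toFun := fun x => ⟨fun n => (x n).1, fun n => (x n).2⟩
        invFun := fun y n => ⟨y.1 n, y.2 n⟩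
        left_inv := fun _ => rfl
        right_inv := fun _ => rfl
        measurable_toFun := Measurable.subtype_mk (measurable_pi_lambda _ fun n =>
          measurable_subtype_coe.comp (measurable_pi_apply n))
        measurable_invFun := measurable_pi_lambda _ fun n => Measurable.subtype_mk
          ((measurable_pi_apply n).comp measurable_subtype_coe) }
    exact (MeasurableEmbedding.subtype_coe hr).comp e.measurableEmbedding
  exact h2.comp h1

theorem traceLaw_univ_le_one (g : M.GenState) : traceLaw g univ ≤ 1 := by
  unfold traceLaw
  rw [Measure.map_apply measurable_toTrace MeasurableSet.univ, preimage_univ,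
    measurableEmbedding_toConfigSeq.comap_apply]
  exact prob_le_one

/-! #### The functional on pseudometrics -/

open Classical in
variable (M) in
/-- The functional `F_k`: generalized states with different sets of true propositions have distance
`1`, the others have distance `k * W(J(m))` between their distributions on traces. -/
noncomputable def functional (k : ℝ) (hk0 : 0 < k) (hk1 : k < 1)
    (m : UnitPseudometric M.GenState) : UnitPseudometric M.GenState where
  dist g g' :=
    if M.props g.1.1 = M.props g'.1.1 then
      k * (m.skorohodJ2.comap (Subtype.val : M.Trace → ℝ≥0 → M.GenState)).wasserstein
        (traceLaw g) (traceLaw g')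
    else 1
  dist_self g := by simp [UnitPseudometric.wasserstein]
  dist_comm g g' := by
    simp only [UnitPseudometric.wasserstein, abs_sub_comm, eq_comm]
  dist_triangle g₁ g₂ g₃ := by
    set m' := m.skorohodJ2.comap (Subtype.val : M.Trace → ℝ≥0 → M.GenState)
    have W0 : ∀ g g' : M.GenState, 0 ≤ k * m'.wasserstein (traceLaw g) (traceLaw g') :=
      fun g g' => mul_nonneg hk0.le (Real.iSup_nonneg fun _ => abs_nonneg _)
    have W1 : ∀ g g' : M.GenState, k * m'.wasserstein (traceLaw g) (traceLaw g') ≤ 1 :=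
      fun g g' => mul_le_one₀ hk1.le (Real.iSup_nonneg fun _ => abs_nonneg _)
        (m'.wasserstein_le_one (traceLaw_univ_le_one g) (traceLaw_univ_le_one g'))
    have tri := m'.wasserstein_triangle (traceLaw_univ_le_one g₁) (traceLaw_univ_le_one g₂)
      (traceLaw_univ_le_one g₃)
    have a := W0 g₁ g₂
    have b := W0 g₂ g₃
    have c := W1 g₁ g₃
    by_cases h₁ : M.props g₁.1.1 = M.props g₂.1.1 <;> by_cases h₂ : M.props g₂.1.1 = M.props g₃.1.1
    · rw [if_pos h₁, if_pos h₂, if_pos (h₁.trans h₂), ← mul_add]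
      exact mul_le_mul_of_nonneg_left tri hk0.le
    · rw [if_pos h₁, if_neg h₂]
      split_ifs <;> linarith
    · rw [if_neg h₁, if_pos h₂]
      split_ifs <;> linarith
    · rw [if_neg h₁, if_neg h₂]
      split_ifs <;> linarith
  dist_nonneg g g' := by
    split_ifs
    · exact mul_nonneg hk0.le (Real.iSup_nonneg fun _ => abs_nonneg _)
    · exact zero_le_one
  dist_le_one g g' := by
    split_ifs
    · exact mul_le_one₀ hk1.le (Real.iSup_nonneg fun _ => abs_nonneg _)
        (UnitPseudometric.wasserstein_le_one _ (traceLaw_univ_le_one g) (traceLaw_univ_le_one g'))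
    · exact le_rfl

variable (M) in
/-- The lattice of pseudometrics on generalized states that give distance `1` to generalized states
with different sets of true propositions, with the order of `UnitPseudometric`. -/
abbrev PropPseudometric : Type _ :=
  {m : UnitPseudometric M.GenState //
    ∀ g g' : M.GenState, M.props g.1.1 ≠ M.props g'.1.1 → m.dist g g' = 1}

variable (M) in
/-- The functional `F_k` on the lattice `PropPseudometric`. -/
noncomputable def propFunctional (k : ℝ) (hk0 : 0 < k) (hk1 : k < 1) (m : M.PropPseudometric) :
    M.PropPseudometric :=
  ⟨M.functional k hk0 hk1 m.1, fun _ _ h => if_neg h⟩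

end

end GSMP

/-! ### The upper integral -/

/-! Everything rests on one kind of estimate between pseudometrics, `m' ≤ c * m + ε` with `c ≥ 1`.
Because distances are at most 1, the uniformity of `m` refines that of `m'` exactly when such a `c`
exists for every `ε > 0` (`uniformity_le_iff`). The estimate passes through the Skorohod distance
and, by inf-convolution of test functions, through the Wasserstein distance, with the same `c` and
`ε`. The factor `k` of the functional then turns `ε` into `k * ε` (`functional_le_mul_add`).

Taking all `ε` shows that the uniformity of `F_k(m)` depends only on that of `m`. Replacing `k` by
another factor rescales distances by a bounded amount, so the induced map `Φ` does not depend on `k`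
(`toPMU_functional_congr`).

Taking `c = 1` shows that `F_k` is monotone and shrinks uniform errors by `k`. Its iterates on `0`
therefore converge uniformly to their supremum, which is a fixed point and lies pointwise below
every other one; in the reversed order it is the maximum. Nothing about the process enters except
that the trace laws have mass at most 1.

For maximality among uniformities, suppose `Φ` fixes the uniformity of `m`. All `F_k^n(m)` then
induce this uniformity, and the least fixed distance is at most `F_k^n(m) + k^n`. Choosing `n` with
`k^n` small gives the required estimate (`toPMU_le_toPMU_leastFixedDist`). -/

theorem iInf_lintegral_le_one {Y : Type*} [MeasurableSpace Y] {P : Measure Y} (hP : P univ ≤ 1)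
    {h : Y → ℝ} (h1 : ∀ y, h y ≤ 1) :
    (⨅ (φ : Y → ℝ≥0∞) (_ : Measurable φ) (_ : ∀ y, ENNReal.ofReal (h y) ≤ φ y), ∫⁻ y, φ y ∂P)
      ≤ 1 := by
  refine iInf_le_of_le (fun _ => 1) (iInf_le_of_le measurable_const
    (iInf_le_of_le (fun y => ?_) ?_))
  · simpa using h1 y
  · simpa using hP

/-- If `φ` is a nearly optimal measurable majorant of `h`, then `c * φ + ε` is a measurable majorant
of `h'`, and the constant costs at most `ε` since the mass is at most 1. No measurability of `h` or
`h'` is needed. -/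
theorem upperIntegral_le_mul_add {Y : Type*} [MeasurableSpace Y] {P : Measure Y} (hP : P univ ≤ 1)
    {h h' : Y → ℝ} (h1 : ∀ y, h y ≤ 1) {c ε : ℝ} (hc : 0 ≤ c) (hε : 0 ≤ ε)
    (hh : ∀ y, h' y ≤ c * h y + ε) :
    upperIntegral P h' ≤ c * upperIntegral P h + ε := by
  have hfin := ((iInf_lintegral_le_one hP h1).trans_lt ENNReal.one_lt_top).ne
  unfold upperIntegral
  set A := ⨅ (φ : Y → ℝ≥0∞) (_ : Measurable φ) (_ : ∀ y, ENNReal.ofReal (h y) ≤ φ y), ∫⁻ y, φ y ∂P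
    with hA
  have key : (⨅ (φ : Y → ℝ≥0∞) (_ : Measurable φ) (_ : ∀ y, ENNReal.ofReal (h' y) ≤ φ y),
      ∫⁻ y, φ y ∂P) ≤ ENNReal.ofReal c * A + ENNReal.ofReal ε := by
    refine ENNReal.le_of_forall_pos_le_add fun η hη _ => ?_
    have hc1 : (0 : ℝ) < c + 1 := by linarith
    -- The slack is later multiplied by `c`, and `c * (η / (c + 1)) ≤ η`; dividing by `c + 1` also
    -- covers `c = 0`.
    have hη' : 0 < ENNReal.ofReal (η / (c + 1)) := by
      rw [ENNReal.ofReal_pos]; positivity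
    obtain ⟨φ, hφ⟩ := iInf_lt_iff.1 (ENNReal.lt_add_right hfin hη'.ne')
    obtain ⟨hm, hφ⟩ := iInf_lt_iff.1 hφ
    obtain ⟨hle, hφ⟩ := iInf_lt_iff.1 hφ
    refine iInf_le_of_le (fun y => ENNReal.ofReal c * φ y + ENNReal.ofReal ε)
      (iInf_le_of_le ((hm.const_mul _).add_const _) (iInf_le_of_le (fun y => ?_) ?_))
    · refine (ENNReal.ofReal_le_ofReal (hh y)).trans (ENNReal.ofReal_add_le.trans ?_)
      rw [ENNReal.ofReal_mul hc]
      exact add_le_add_left (mul_le_mul_right (hle y) _) _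
    · rw [lintegral_add_right _ measurable_const, lintegral_const_mul _ hm, lintegral_const]
      calc ENNReal.ofReal c * ∫⁻ y, φ y ∂P + ENNReal.ofReal ε * P univ
          ≤ ENNReal.ofReal c * (A + ENNReal.ofReal (η / (c + 1))) + ENNReal.ofReal ε * 1 := by
            gcongr
        _ = ENNReal.ofReal c * A + ENNReal.ofReal ε + ENNReal.ofReal (c * (η / (c + 1))) := by
            rw [ENNReal.ofReal_mul hc]; ring
        _ ≤ _ := by
            gcongr
            rw [← ENNReal.ofReal_coe_nnreal]
            refine ENNReal.ofReal_le_ofReal ?_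
            rw [mul_div_assoc', div_le_iff₀ hc1]
            nlinarith [η.coe_nonneg]
  have h2 : (ENNReal.ofReal c * A + ENNReal.ofReal ε).toReal = c * A.toReal + ε := by
    rw [ENNReal.toReal_add (ENNReal.mul_ne_top ENNReal.ofReal_ne_top hfin) ENNReal.ofReal_ne_top,
      ENNReal.toReal_mul, ENNReal.toReal_ofReal hc, ENNReal.toReal_ofReal hε]
  rw [← h2]
  exact ENNReal.toReal_mono
    (ENNReal.add_ne_top.2 ⟨ENNReal.mul_ne_top ENNReal.ofReal_ne_top hfin, ENNReal.ofReal_ne_top⟩) key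

namespace UnitPseudometric

/-! ### Comparison of pseudometrics up to a factor and an error -/

theorem j2Excess_le_mul_add {X : Type*} {m m' : UnitPseudometric X} {c ε : ℝ} (hc : 1 ≤ c)
    (hε : 0 ≤ ε) (h : ∀ x y, m'.dist x y ≤ c * m.dist x y + ε) (f g : ℝ≥0 → X) :
    m'.j2Excess f g ≤ c * m.j2Excess f g + ε := by
  have hc0 : 0 < c := by linarith
  refine ciSup_le fun t => ?_
  refine le_trans ?_ (add_le_add_left (mul_le_mul_of_nonneg_left
    (le_ciSup (m.j2_bddAbove f g) t) hc0.le) ε)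
  rw [Real.mul_iInf_of_nonneg hc0.le, ← sub_le_iff_le_add]
  refine le_ciInf fun t' => ?_
  rw [sub_le_iff_le_add]
  refine (ciInf_le (m'.j2_bddBelow f g t) t').trans (max_le ?_ ?_)
  · refine (h _ _).trans ?_
    gcongr
    exact le_max_left _ _
  -- The time term is the same for both pseudometrics; this is where `c ≥ 1` is needed.
  · have h1 := le_max_right (m.dist (f t) (g t')) |(t : ℝ) - t'|
    have h2 := abs_nonneg ((t : ℝ) - t')
    nlinarith

theorem skorohodJ2_dist_eq {X : Type*} (m : UnitPseudometric X) (f g : ℝ≥0 → X) :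
    m.skorohodJ2.dist f g = max (m.j2Excess f g) (m.j2Excess g f) := by
  change max _ _ = max _ _
  congr 1
  unfold j2Excess
  congr 1; ext t; congr 1; ext t'; rw [m.dist_comm, abs_sub_comm]

theorem skorohodJ2_le_mul_add {X : Type*} {m m' : UnitPseudometric X} {c ε : ℝ} (hc : 1 ≤ c)
    (hε : 0 ≤ ε) (h : ∀ x y, m'.dist x y ≤ c * m.dist x y + ε) (f g : ℝ≥0 → X) :
    m'.skorohodJ2.dist f g ≤ c * m.skorohodJ2.dist f g + ε := by
  rw [skorohodJ2_dist_eq, skorohodJ2_dist_eq]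
  have hc0 : 0 ≤ c := by linarith
  refine max_le ((j2Excess_le_mul_add hc hε h f g).trans ?_)
    ((j2Excess_le_mul_add hc hε h g f).trans ?_)
  · gcongr; exact le_max_left _ _
  · gcongr; exact le_max_right _ _

/-- The inf-convolution of a test function with a multiple of another pseudometric. -/
theorem exists_testFunction_approx {Y : Type*} (d : UnitPseudometric Y) {h : Y → ℝ}
    (h0 : ∀ y, 0 ≤ h y) (h1 : ∀ y, h y ≤ 1) {c ε : ℝ} (hc : 1 ≤ c)
    (hh : ∀ x y, h x ≤ h y + (c * d.dist x y + ε)) :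
    ∃ l : d.TestFunction, ∀ y, c * l.1 y ≤ h y ∧ h y ≤ c * l.1 y + ε := by
  have hc0 : 0 < c := by linarith
  -- `w` is the largest minorant of `h` that is Lipschitz with constant `c` for `d`. By `hh` it
  -- loses at most `ε`, and `w / c` is the test function.
  let w : Y → ℝ := fun x => ⨅ y, (h y + c * d.dist x y)
  have bdd : ∀ x, BddBelow (range fun y => h y + c * d.dist x y) := fun x =>
    ⟨0, by rintro _ ⟨y, rfl⟩; exact add_nonneg (h0 y) (mul_nonneg hc0.le (d.dist_nonneg _ _))⟩
  have w0 : ∀ x, 0 ≤ w x := fun x =>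
    Real.iInf_nonneg fun y => add_nonneg (h0 y) (mul_nonneg hc0.le (d.dist_nonneg _ _))
  have wh : ∀ x, w x ≤ h x := fun x => (ciInf_le (bdd x) x).trans (by simp [d.dist_self])
  have hw : ∀ x, h x ≤ w x + ε := fun x => by
    have : Nonempty Y := ⟨x⟩
    rw [← sub_le_iff_le_add]
    exact le_ciInf fun y => by linarith [hh x y]
  have wl : ∀ x x', w x - w x' ≤ c * d.dist x x' := fun x x' => by
    have : Nonempty Y := ⟨x⟩
    rw [sub_le_comm]
    refine le_ciInf fun y => ?_
    have := ciInf_le (bdd x) y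
    have t := mul_le_mul_of_nonneg_left (d.dist_triangle x x' y) hc0.le
    change w x ≤ _ at this
    linarith
  refine ⟨⟨fun x => w x / c, fun x => ⟨div_nonneg (w0 x) hc0.le, ?_⟩, fun x y => ?_⟩, fun x => ?_⟩
  · rw [div_le_one hc0]
    linarith [wh x, h1 x]
  · rw [← sub_div, abs_div, abs_of_pos hc0, div_le_iff₀ hc0, mul_comm]
    refine abs_sub_le_iff.2 ⟨wl x y, ?_⟩
    rw [d.dist_comm]
    exact wl y x
  · change c * (w x / c) ≤ _ ∧ _ ≤ c * (w x / c) + ε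
    rw [mul_div_cancel₀ _ hc0.ne']
    exact ⟨wh x, hw x⟩

/-- A test function `f` for `d'` lies between `c * l` and `c * l + ε` for some test function `l` for
`d`. The error is one-sided, so a difference of two integrals loses `ε` and not `2 * ε`; this is
what later gives contraction for every `k < 1`. -/
theorem wasserstein_le_mul_add {Y : Type*} [MeasurableSpace Y] {d d' : UnitPseudometric Y}
    {c ε : ℝ} (hc : 1 ≤ c) (hε : 0 ≤ ε) (h : ∀ x y, d'.dist x y ≤ c * d.dist x y + ε)
    {P Q : Measure Y} (hP : P univ ≤ 1) (hQ : Q univ ≤ 1) :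
    d'.wasserstein P Q ≤ c * d.wasserstein P Q + ε := by
  have hc0 : 0 ≤ c := by linarith
  refine ciSup_le fun f => ?_
  obtain ⟨l, hl⟩ := d.exists_testFunction_approx (fun y => (f.2.1 y).1) (fun y => (f.2.1 y).2) hc
    (ε := ε) fun x y => by linarith [(abs_le.1 (f.2.2 x y)).2, h x y]
  have hup : ∀ {R : Measure Y}, R univ ≤ 1 → upperIntegral R f.1 ≤ c * upperIntegral R l.1 + ε :=
    fun hR => upperIntegral_le_mul_add hR (fun y => (l.2.1 y).2) hc0 hε fun y => (hl y).2
  have hlo : ∀ {R : Measure Y}, R univ ≤ 1 → c * upperIntegral R l.1 ≤ upperIntegral R f.1 := by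
    intro R hR
    have hc' : 0 < c := by linarith
    -- The lower bound is the same comparison applied to `l ≤ c⁻¹ * f`, with no additive error.
    have := upperIntegral_le_mul_add (h := f.1) (h' := l.1) hR (fun y => (f.2.1 y).2)
      (inv_nonneg.2 hc0) le_rfl fun y => by
        rw [add_zero, inv_mul_eq_div, le_div_iff₀ hc', mul_comm]
        exact (hl y).1
    rwa [add_zero, inv_mul_eq_div, le_div_iff₀ hc', mul_comm] at this
  have hW : |upperIntegral P l.1 - upperIntegral Q l.1| ≤ d.wasserstein P Q :=
    le_ciSup (f := fun l : d.TestFunction => |upperIntegral P l.1 - upperIntegral Q l.1|)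
      ⟨1, by rintro _ ⟨h, rfl⟩; exact d.abs_upperIntegral_sub_le_one hP hQ h⟩ l
  obtain ⟨h1, h2⟩ := abs_le.1 hW
  have h1 := mul_le_mul_of_nonneg_left h1 hc0
  have h2 := mul_le_mul_of_nonneg_left h2 hc0
  have a := hup hP
  have b := hup hQ
  have a' := hlo hP
  have b' := hlo hQ
  exact abs_le.2 ⟨by linarith, by linarith⟩

/-! ### Refinement of uniformities as an estimate between pseudometrics -/

theorem hasBasis_uniformity {X : Type*} (m : UnitPseudometric X) :
    (@_root_.uniformity X m.uniformity).HasBasis (fun ε : ℝ => 0 < ε)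
      fun ε => {p | m.dist p.1 p.2 < ε} :=
  UniformSpace.hasBasis_ofFun ⟨1, one_pos⟩ _ _ _ _ _

/-- Where `m < δ`, the distance `m'` is below `ε`; where `m ≥ δ`, the bound `m' ≤ 1 ≤ δ⁻¹ * m`
holds. This turns an entourage condition into an inequality that can be carried through the
functional. -/
theorem uniformity_le_iff {X : Type*} {m m' : UnitPseudometric X} :
    m.uniformity ≤ m'.uniformity ↔
      ∀ ε > 0, ∃ c ≥ (1 : ℝ), ∀ x y, m'.dist x y ≤ c * m.dist x y + ε := by
  change @_root_.uniformity X m.uniformity ≤ @_root_.uniformity X m'.uniformity ↔ _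
  rw [m.hasBasis_uniformity.le_basis_iff m'.hasBasis_uniformity]
  constructor
  · intro H ε hε
    obtain ⟨δ, hδ, h⟩ := H ε hε
    refine ⟨max 1 δ⁻¹, le_max_left _ _, fun x y => ?_⟩
    have h0 : 0 ≤ max 1 δ⁻¹ * m.dist x y :=
      mul_nonneg (zero_le_one.trans (le_max_left _ _)) (m.dist_nonneg x y)
    rcases lt_or_ge (m.dist x y) δ with hxy | hxy
    · have : m'.dist x y < ε := h (show (x, y) ∈ {p : X × X | m.dist p.1 p.2 < δ} from hxy)
      linarith
    · have h1 : δ⁻¹ * δ ≤ max 1 δ⁻¹ * m.dist x y := by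
        gcongr
        exact le_max_right _ _
      rw [inv_mul_cancel₀ hδ.ne'] at h1
      linarith [m'.dist_le_one x y]
  · intro H ε hε
    obtain ⟨c, hc, h⟩ := H (ε / 2) (half_pos hε)
    have hc0 : 0 < c := by linarith
    refine ⟨ε / 2 / c, by positivity, fun p hp => ?_⟩
    have hp : m.dist p.1 p.2 < ε / 2 / c := hp
    rw [lt_div_iff₀ hc0, mul_comm] at hp
    change m'.dist p.1 p.2 < ε
    linarith [h p.1 p.2]

theorem toPMU_le_iff {X : Type*} {m m' : UnitPseudometric X} :
    m.toPMU ≤ m'.toPMU ↔ ∀ ε > 0, ∃ c ≥ (1 : ℝ), ∀ x y, m'.dist x y ≤ c * m.dist x y + ε :=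
  uniformity_le_iff

/-- The pseudometric that is constantly `0`. -/
instance (X : Type*) : Zero (UnitPseudometric X) where
  zero :=
    { dist := fun _ _ => 0
      dist_self := fun _ => rfl
      dist_comm := fun _ _ => rfl
      dist_triangle := fun _ _ _ => by simp
      dist_nonneg := fun _ _ => le_rfl
      dist_le_one := fun _ _ => zero_le_one }

theorem bddAbove_range_dist {X ι : Type*} (a : ι → UnitPseudometric X) (x y : X) :
    BddAbove (range fun i => (a i).dist x y) :=
  ⟨1, by rintro _ ⟨i, rfl⟩; exact (a i).dist_le_one x y⟩

/-- The pointwise supremum of a nonempty family of pseudometrics. -/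
noncomputable def iSupDist {X ι : Type*} [Nonempty ι] (a : ι → UnitPseudometric X) :
    UnitPseudometric X where
  dist x y := ⨆ i, (a i).dist x y
  dist_self x := by simp [dist_self]
  dist_comm x y := by simp only [dist_comm]
  dist_triangle x y z := ciSup_le fun i => ((a i).dist_triangle x y z).trans
    (add_le_add (le_ciSup (bddAbove_range_dist a x y) i) (le_ciSup (bddAbove_range_dist a y z) i))
  dist_nonneg x y := Real.iSup_nonneg fun i => (a i).dist_nonneg x y
  dist_le_one x y := ciSup_le fun i => (a i).dist_le_one x y

theorem le_iSupDist {X ι : Type*} [Nonempty ι] (a : ι → UnitPseudometric X) (i : ι) (x y : X) :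
    (a i).dist x y ≤ (iSupDist a).dist x y :=
  le_ciSup (bddAbove_range_dist a x y) i

theorem iSupDist_le {X ι : Type*} [Nonempty ι] {a : ι → UnitPseudometric X} {x y : X} {r : ℝ}
    (h : ∀ i, (a i).dist x y ≤ r) : (iSupDist a).dist x y ≤ r :=
  ciSup_le h

end UnitPseudometric

namespace GSMP

variable {AP S E : Type*} [Fintype S] {M : GSMP AP S E}

/-! ### The functional on pseudometrics -/

/-- Between states with equal propositions the whole Wasserstein bound is multiplied by `k`;
otherwise both distances are 1 and `c ≥ 1` suffices. For `c = 1` this is contraction by `k`. -/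
theorem functional_le_mul_add {m m' : UnitPseudometric M.GenState} {c ε : ℝ} (hc : 1 ≤ c)
    (hε : 0 ≤ ε) (h : ∀ g g', m'.dist g g' ≤ c * m.dist g g' + ε) {k : ℝ} (hk0 : 0 < k)
    (hk1 : k < 1) (g g' : M.GenState) :
    (M.functional k hk0 hk1 m').dist g g' ≤
      c * (M.functional k hk0 hk1 m).dist g g' + k * ε := by
  unfold functional
  dsimp only
  split_ifs
  · refine (mul_le_mul_of_nonneg_left (UnitPseudometric.wasserstein_le_mul_add
      (d := m.skorohodJ2.comap (Subtype.val : M.Trace → ℝ≥0 → M.GenState)) hc hε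
      (fun x y => UnitPseudometric.skorohodJ2_le_mul_add hc hε h x.1 y.1)
      (traceLaw_univ_le_one g) (traceLaw_univ_le_one g')) hk0.le).trans_eq ?_
    ring
  · have := mul_nonneg hk0.le hε
    linarith

theorem functional_mono {m m' : UnitPseudometric M.GenState}
    (h : ∀ g g', m'.dist g g' ≤ m.dist g g') {k : ℝ} (hk0 : 0 < k) (hk1 : k < 1)
    (g g' : M.GenState) :
    (M.functional k hk0 hk1 m').dist g g' ≤ (M.functional k hk0 hk1 m).dist g g' := by
  simpa using functional_le_mul_add le_rfl le_rfl (by simpa using h) hk0 hk1 g g'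

theorem functional_le_of_ne {k l : ℝ} (hk0 : 0 < k) (hk1 : k < 1) (hl0 : 0 < l) (hl1 : l < 1)
    (m : UnitPseudometric M.GenState) (g g' : M.GenState) :
    (M.functional l hl0 hl1 m).dist g g' ≤
      max 1 (l / k) * (M.functional k hk0 hk1 m).dist g g' := by
  unfold functional
  dsimp only
  split_ifs
  · rw [← mul_assoc]
    refine mul_le_mul_of_nonneg_right ?_ (Real.iSup_nonneg fun _ => abs_nonneg _)
    rw [← div_le_iff₀ hk0]
    exact le_max_right _ _
  · simp

theorem toPMU_functional_le {m m' : UnitPseudometric M.GenState} (h : m.toPMU ≤ m'.toPMU)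
    {k l : ℝ} (hk0 : 0 < k) (hk1 : k < 1) (hl0 : 0 < l) (hl1 : l < 1) :
    (M.functional k hk0 hk1 m).toPMU ≤ (M.functional l hl0 hl1 m').toPMU := by
  rw [UnitPseudometric.toPMU_le_iff] at h ⊢
  intro ε hε
  obtain ⟨c, hc, hm⟩ := h ε hε
  -- The ratio `l / k` alone would fail for `l < k`, since states with different propositions stay
  -- at distance 1 for both factors.
  have h1 : 1 ≤ max 1 (l / k) := le_max_left _ _
  refine ⟨c * max 1 (l / k), one_le_mul_of_one_le_of_one_le hc h1, fun g g' => ?_⟩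
  have a := functional_le_mul_add hc hε.le hm hl0 hl1 g g'
  have b := mul_le_mul_of_nonneg_left (functional_le_of_ne hk0 hk1 hl0 hl1 m g g')
    (zero_le_one.trans hc)
  rw [← mul_assoc] at b
  have : l * ε ≤ ε := mul_le_of_le_one_left hε.le hl1.le
  linarith

theorem toPMU_functional_congr {m m' : UnitPseudometric M.GenState} (h : m.toPMU = m'.toPMU)
    {k l : ℝ} (hk0 : 0 < k) (hk1 : k < 1) (hl0 : 0 < l) (hl1 : l < 1) :
    (M.functional k hk0 hk1 m).toPMU = (M.functional l hl0 hl1 m').toPMU :=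
  le_antisymm (toPMU_functional_le h.le _ _ _ _) (toPMU_functional_le h.ge _ _ _ _)

/-! ### Iteration from the zero pseudometric and the extremal fixed point -/

section Iterate

variable {k : ℝ} (hk0 : 0 < k) (hk1 : k < 1)

theorem iterate_functional_mono {m m' : UnitPseudometric M.GenState}
    (h : ∀ g g', m'.dist g g' ≤ m.dist g g') (n : ℕ) (g g' : M.GenState) :
    ((M.functional k hk0 hk1)^[n] m').dist g g' ≤ ((M.functional k hk0 hk1)^[n] m).dist g g' := by
  induction n generalizing g g' with
  | zero => exact h g g'
  | succ n ih =>
    rw [Function.iterate_succ_apply', Function.iterate_succ_apply']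
    exact functional_mono ih hk0 hk1 g g'

/-- Any two pseudometrics differ by at most `1 = k ^ 0`, and each application of the functional
multiplies the error by `k`. -/
theorem iterate_functional_le_add_pow (m m' : UnitPseudometric M.GenState) (n : ℕ)
    (g g' : M.GenState) :
    ((M.functional k hk0 hk1)^[n] m').dist g g' ≤
      ((M.functional k hk0 hk1)^[n] m).dist g g' + k ^ n := by
  induction n generalizing g g' with
  | zero => simpa using (m'.dist_le_one g g').trans (by linarith [m.dist_nonneg g g'])
  | succ n ih =>
    rw [Function.iterate_succ_apply', Function.iterate_succ_apply', pow_succ']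
    simpa using functional_le_mul_add le_rfl (pow_nonneg hk0.le n) (by simpa using ih) hk0 hk1 g g'

variable (M) in
/-- The pointwise supremum of the iterates of the functional on the zero pseudometric. -/
noncomputable def leastFixedDist : UnitPseudometric M.GenState :=
  UnitPseudometric.iSupDist fun n : ℕ => (M.functional k hk0 hk1)^[n] 0

theorem iterate_le_leastFixedDist (n : ℕ) (g g' : M.GenState) :
    ((M.functional k hk0 hk1)^[n] 0).dist g g' ≤ (M.leastFixedDist hk0 hk1).dist g g' :=
  UnitPseudometric.le_iSupDist (fun n : ℕ => (M.functional k hk0 hk1)^[n] 0) n g g'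

theorem leastFixedDist_le_iterate_add_pow (m : UnitPseudometric M.GenState) (n : ℕ)
    (g g' : M.GenState) :
    (M.leastFixedDist hk0 hk1).dist g g' ≤
      ((M.functional k hk0 hk1)^[n] m).dist g g' + k ^ n := by
  refine UnitPseudometric.iSupDist_le fun j => ?_
  refine le_trans ?_ (iterate_functional_le_add_pow hk0 hk1 m ((M.functional k hk0 hk1)^[j] 0) n
    g g')
  -- With `F` the functional, `F^j(0) ≤ F^j(F^n(0)) = F^n(F^j(0))` by monotonicity, and `F^n`
  -- forgets its starting point up to `k ^ n`.
  rw [← Function.iterate_add_apply, add_comm, Function.iterate_add_apply]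
  exact iterate_functional_mono hk0 hk1
    (fun g g' => ((M.functional k hk0 hk1)^[n] 0).dist_nonneg g g') j g g'

/-- Uniform convergence of the iterates replaces a continuity argument: applying the functional to
the supremum exceeds the next iterate by at most `k ^ (n + 1)`, which tends to 0. The other
inequality is monotonicity. -/
theorem functional_leastFixedDist :
    M.functional k hk0 hk1 (M.leastFixedDist hk0 hk1) = M.leastFixedDist hk0 hk1 := by
  refine UnitPseudometric.ext (funext₂ fun g g' => le_antisymm ?_ ?_)
  · have hlim : Filter.Tendsto
        (fun n : ℕ => (M.leastFixedDist hk0 hk1).dist g g' + k ^ (n + 1)) Filter.atTop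
        (nhds ((M.leastFixedDist hk0 hk1).dist g g' + 0)) :=
      ((tendsto_pow_atTop_nhds_zero_of_lt_one hk0.le hk1).comp
        (Filter.tendsto_add_atTop_nat 1)).const_add _
    rw [add_zero] at hlim
    refine ge_of_tendsto' hlim fun n => ?_
    have h := functional_le_mul_add le_rfl (pow_nonneg hk0.le n)
      (m := (M.functional k hk0 hk1)^[n] 0) (by simpa using leastFixedDist_le_iterate_add_pow hk0 hk1 0 n) hk0 hk1 g g'
    rw [one_mul, ← pow_succ', ← Function.iterate_succ_apply' (M.functional k hk0 hk1)] at h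
    exact h.trans (add_le_add_left (iterate_le_leastFixedDist hk0 hk1 (n + 1) g g') _)
  · refine UnitPseudometric.iSupDist_le fun n => ?_
    cases n with
    | zero => exact UnitPseudometric.dist_nonneg _ _ _
    | succ n =>
      rw [Function.iterate_succ_apply']
      exact functional_mono (iterate_le_leastFixedDist hk0 hk1 n) hk0 hk1 g g'

theorem leastFixedDist_le {m : UnitPseudometric M.GenState}
    (hm : M.functional k hk0 hk1 m = m) (g g' : M.GenState) :
    (M.leastFixedDist hk0 hk1).dist g g' ≤ m.dist g g' :=
  UnitPseudometric.iSupDist_le fun n => by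
    simpa [Function.iterate_fixed hm n] using
      iterate_functional_mono hk0 hk1 (m := m) (m' := 0) m.dist_nonneg n g g'

theorem toPMU_iterate_functional {m : UnitPseudometric M.GenState}
    (hm : (M.functional k hk0 hk1 m).toPMU = m.toPMU) (n : ℕ) :
    ((M.functional k hk0 hk1)^[n] m).toPMU = m.toPMU := by
  induction n with
  | zero => rfl
  | succ n ih =>
    rw [Function.iterate_succ_apply']
    exact (toPMU_functional_congr ih hk0 hk1 hk0 hk1).trans hm

/-- Only the uniformity of `m` is fixed, so `m` need not dominate the least fixed distance. An
iterate of `m` does, up to `k ^ n`, and it is still uniformly equivalent to `m`; half of `ε` pays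
for each comparison. -/
theorem toPMU_le_toPMU_leastFixedDist {m : UnitPseudometric M.GenState}
    (hm : (M.functional k hk0 hk1 m).toPMU = m.toPMU) :
    m.toPMU ≤ (M.leastFixedDist hk0 hk1).toPMU := by
  rw [UnitPseudometric.toPMU_le_iff]
  intro ε hε
  obtain ⟨n, hn⟩ := exists_pow_lt_of_lt_one (half_pos hε) hk1
  obtain ⟨c, hc, h⟩ := UnitPseudometric.toPMU_le_iff.1
    (toPMU_iterate_functional hk0 hk1 hm n).ge (ε / 2) (half_pos hε)
  refine ⟨c, hc, fun g g' => ?_⟩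
  linarith [h g g', leastFixedDist_le_iterate_add_pow hk0 hk1 m n g g']

end Iterate

variable (M) in
/-- The map on pseudo-metrizable uniformities that is induced by the functionals `F_k`. -/
noncomputable def uniformityFunctional (U : PseudoMetrizableUniformity M.GenState) :
    PseudoMetrizableUniformity M.GenState :=
  (M.functional (1 / 2) one_half_pos one_half_lt_one U.2.choose).toPMU

/-- The factor `1 / 2` and the chosen pseudometric in the definition are immaterial, since both can
be changed without changing the resulting uniformity. -/
theorem uniformityFunctional_toPMU {k : ℝ} (hk0 : 0 < k) (hk1 : k < 1)
    (m : UnitPseudometric M.GenState) :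
    M.uniformityFunctional m.toPMU = (M.functional k hk0 hk1 m).toPMU :=
  toPMU_functional_congr (Subtype.ext m.toPMU.2.choose_spec) _ _ _ _

end GSMP

theorem mainTheorem2 {AP S E : Type*} [Fintype S] (M : GSMP AP S E) :
    ∃ Φ : PseudoMetrizableUniformity M.GenState → PseudoMetrizableUniformity M.GenState,
      ∀ (k : ℝ) (hk0 : 0 < k) (hk1 : k < 1),
        (∀ m : UnitPseudometric M.GenState, Φ m.toPMU = (M.functional k hk0 hk1 m).toPMU) ∧
        ∃ mF : M.PropPseudometric,
          IsGreatest (Function.fixedPoints (M.propFunctional k hk0 hk1)) mF ∧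
          IsGreatest (Function.fixedPoints Φ) mF.1.toPMU := by
  refine ⟨M.uniformityFunctional, fun k hk0 hk1 =>
    ⟨GSMP.uniformityFunctional_toPMU hk0 hk1, ?_⟩⟩
  have hfix := GSMP.functional_leastFixedDist (M := M) hk0 hk1
  refine ⟨⟨M.leastFixedDist hk0 hk1, fun g g' h => ?_⟩, ⟨Subtype.ext hfix, fun m hm => ?_⟩, ?_, ?_⟩
  -- The supremum includes the zero pseudometric, so distance 1 for different propositions is read
  -- off from the fixed-point equation.
  · rw [← hfix]
    exact if_neg h
  · exact GSMP.leastFixedDist_le hk0 hk1 (congrArg Subtype.val hm)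
  · exact (GSMP.uniformityFunctional_toPMU hk0 hk1 _).trans (congrArg _ hfix)
  · rintro ⟨_, m, rfl⟩ hm
    exact GSMP.toPMU_le_toPMU_leastFixedDist hk0 hk1
      ((GSMP.uniformityFunctional_toPMU hk0 hk1 m).symm.trans hm)
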